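/- Let $D^2=\{x\in\mathbb{R}^2:|x|<1\}$ and write $\nabla^\perp b=(-\partial_{x_2}b,\partial_{x_1}b)$. There exist $a,b\in L^\infty(D^2)\cap H^1(D^2)$ such that the Neumann problem $$-\Delta\varphi=\nabla a\cdot\nabla^{\perp}b\quad\text{in }D^2,\qquad \partial_\nu\varphi=0\quad\text{on }\partial D^2,$$ has a zero-mean weak solution, and no zero-mean weak solution of it belongs to $H^1(D^2)$. Here a zero-mean weak solution is a function $\varphi\in W^{1,1}(D^2)$ with $\int_{D^2}\varphi\,dx=0$ and $$\int_{D^2}\nabla\varphi\cdot\nabla\zeta\,dx=\int_{D^2}(\nabla a\cdot\nabla^\perp b)\,\zeta\,dx\qquad\text{for every }\zeta\in C^\infty(\overline{D^2}).$$ -/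

import Mathlib

open MeasureTheory
open scoped ContDiff ENNReal

namespace NeumannJacobian

/-- The Euclidean plane. -/
abbrev Plane : Type := EuclideanSpace ℝ (Fin 2)

/-- The open unit disc `D²`. -/
def disc : Set Plane := Metric.ball 0 1

/-- Lebesgue measure on the disc. -/
noncomputable def discMeasure : Measure Plane := volume.restrict disc

/-- The classical partial derivative `∂ᵢ ζ (x)` (used for smooth functions only). -/
noncomputable def partialDeriv (i : Fin 2) (ζ : Plane → ℝ) (x : Plane) : ℝ :=
  fderiv ℝ ζ x (EuclideanSpace.single i 1)

/-- `u` belongs to `W^{1,p}(D²)` and its weak (distributional) gradient is `G`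
(meant for `1 ≤ p`). -/
structure HasWeakGradient (p : ℝ≥0∞) (u : Plane → ℝ) (G : Plane → Plane) : Prop where
  memLp : MemLp u p discMeasure
  memLp_grad : MemLp G p discMeasure
  integral_eq : ∀ ξ : Plane → ℝ, ContDiff ℝ ∞ ξ → HasCompactSupport ξ → tsupport ξ ⊆ disc →
    ∀ i : Fin 2, ∫ x, u x * partialDeriv i ξ x ∂discMeasure = -∫ x, G x i * ξ x ∂discMeasure

/-- Membership in `H¹(D²) = W^{1,2}(D²)`. -/
def MemH1 (u : Plane → ℝ) : Prop := ∃ G : Plane → Plane, HasWeakGradient 2 u G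

/-- Rotation by a right angle: `(v₁, v₂)^⊥ = (-v₂, v₁)`. -/
noncomputable def perp (v : Plane) : Plane := !₂[-v 1, v 0]

/-- `φ ∈ W^{1,1}(D²)` has zero mean and solves `-Δφ = f` in `D²`, `∂_ν φ = 0` on `∂D²` in the weak
sense: `∫ ∇φ · ∇ζ = ∫ f ζ` over the disc for every `ζ` that is smooth up to the boundary. -/
def IsZeroMeanNeumannSolution (f φ : Plane → ℝ) : Prop :=
  ∫ x, φ x ∂discMeasure = 0 ∧
  ∃ Φ : Plane → Plane, HasWeakGradient 1 φ Φ ∧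
    ∀ ζ : Plane → ℝ, ContDiff ℝ ∞ ζ →
      ∫ x, ∑ i : Fin 2, Φ x i * partialDeriv i ζ x ∂discMeasure = ∫ x, f x * ζ x ∂discMeasure

end NeumannJacobian

/-!
The Dirichlet integral and the Jacobian `∇a · ∇^⊥ b dx` are conformally invariant, so the problem is
moved by `w = log ((1 + z) / (1 - z)) = t + iθ` from the disc to the strip `|θ| < π / 2`. The two
boundary points `±1` become the ends `t = ±∞`, and the lines `t = const` meet the boundary of the
strip at right angles. Hence a function of `t` alone has zero normal derivative, and
`a = α(t)`, `b = β(t) θ` give `∇a · ∇^⊥ b = -α'(t) β(t) |∇t|²`. If `g' = α' β`, and `g` vanishes at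
both ends, then a primitive of `g`, taken as a function of `t`, solves the Neumann problem
(`integral_mul_fderiv_gradT`, an integration by parts along the lines `θ = const`).

The functions `a` and `b` have finite Dirichlet energy as soon as `α'`, `β` and `β'` are square
integrable on the line, which makes `α' β` integrable; but its primitive `g` need not be square
integrable. With `J = √(1 + t²)` the choice `α = J^(-3/4) sin J`, `β = J^(-3/4) cos J` has the
explicit primitive `g = -J^(-1/2) + J^(-3/2) sin J cos J / 2` (`hasDerivAt_flux`), which behaves
like `-|t|^(-1/2)`. As `J` is even, `g` vanishes at both ends, so the compatibility condition holds.
All functions are smooth in the open disc, with singularities only at `±1`, so their classical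
gradients are weak gradients (`HasWeakGradient.of_hasGradientAt`).

Let `ψ` be any solution whose weak gradient `G` is square integrable. Since `tanh t` is the
restriction of `2 x₁ / (1 + |x|²)`, which is smooth in the plane (`tanh_coord_re`), every function
of `t` that is constant near both ends is an admissible test function. Testing with one whose
derivative is `h(t) = η(t) J^(-1/2)`, for a cutoff function `η`, bounds `∫ η² / J dt` by a multiple
of `∫ |G|²` (`integral_inv_bracket_le`), which is absurd because `1 / J` is not integrable.
-/

namespace NeumannJacobian

open Set Filter Topology

/-! ### The conformal map between the disc and a strip -/

/-- The strip `{|Im w| < π / 2}`. -/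
def strip : Set ℂ := Complex.im ⁻¹' Ioo (-(Real.pi / 2)) (Real.pi / 2)

/-- The conformal map `z ↦ log ((1 + z) / (1 - z))` from the unit disc onto the strip. -/
noncomputable def toStrip (z : ℂ) : ℂ := Complex.log ((1 + z) / (1 - z))

/-- The inverse `w ↦ (exp w - 1) / (exp w + 1)` of `toStrip`. -/
noncomputable def ofStrip (w : ℂ) : ℂ := (Complex.exp w - 1) / (Complex.exp w + 1)

lemma re_exp_pos {w : ℂ} (hw : w ∈ strip) : 0 < (Complex.exp w).re := by
  rw [Complex.exp_re]
  exact mul_pos (Real.exp_pos _) (Real.cos_pos_of_mem_Ioo hw)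

lemma exp_add_one_ne_zero {w : ℂ} (hw : w ∈ strip) : Complex.exp w + 1 ≠ 0 := by
  intro h
  have h1 := congrArg Complex.re h
  have h2 := re_exp_pos hw
  simp only [Complex.add_re, Complex.one_re, Complex.zero_re] at h1
  linarith

lemma toStrip_ofStrip {w : ℂ} (hw : w ∈ strip) : toStrip (ofStrip w) = w := by
  have h := exp_add_one_ne_zero hw
  have h1 : (1 + ofStrip w) / (1 - ofStrip w) = Complex.exp w := by
    unfold ofStrip
    field_simp
    ring_nf
  rw [toStrip, h1, Complex.log_exp]
  · linarith [hw.1, Real.pi_pos]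
  · linarith [hw.2, Real.pi_pos]

lemma norm_ofStrip_lt_one {w : ℂ} (hw : w ∈ strip) : ‖ofStrip w‖ < 1 := by
  have h := re_exp_pos hw
  rw [ofStrip, norm_div, div_lt_one (norm_pos_iff.2 (exp_add_one_ne_zero hw)),
    ← sq_lt_sq₀ (norm_nonneg _) (norm_nonneg _), Complex.sq_norm, Complex.sq_norm,
    Complex.normSq_apply, Complex.normSq_apply]
  simp only [Complex.sub_re, Complex.sub_im, Complex.add_re, Complex.add_im, Complex.one_re,
    Complex.one_im]
  nlinarith

lemma one_sub_ne_zero_of_norm_lt {z : ℂ} (hz : ‖z‖ < 1) : 1 - z ≠ 0 := by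
  intro h
  rw [← sub_eq_zero.1 h] at hz
  simp at hz

lemma one_add_ne_zero_of_norm_lt {z : ℂ} (hz : ‖z‖ < 1) : 1 + z ≠ 0 := by
  have := one_sub_ne_zero_of_norm_lt (z := -z) (by simpa using hz)
  simpa using this

lemma re_cayley_pos {z : ℂ} (hz : ‖z‖ < 1) : 0 < ((1 + z) / (1 - z)).re := by
  have h1 : 0 < Complex.normSq (1 - z) := Complex.normSq_pos.2 (one_sub_ne_zero_of_norm_lt hz)
  have h2 : z.re ^ 2 + z.im ^ 2 < 1 := by
    have : ‖z‖ ^ 2 < 1 := by nlinarith [norm_nonneg z]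
    rw [Complex.sq_norm, Complex.normSq_apply] at this
    nlinarith
  rw [Complex.div_re, ← add_div]
  apply div_pos _ h1
  simp only [Complex.sub_re, Complex.sub_im, Complex.add_re, Complex.add_im, Complex.one_re,
    Complex.one_im]
  nlinarith

lemma toStrip_mem_strip {z : ℂ} (hz : ‖z‖ < 1) : toStrip z ∈ strip := by
  have h := re_cayley_pos hz
  have := Complex.abs_arg_lt_pi_div_two_iff.2 (Or.inl h)
  rw [abs_lt] at this
  simpa [strip, toStrip, Complex.log_im] using this

lemma exp_toStrip {z : ℂ} (hz : ‖z‖ < 1) : Complex.exp (toStrip z) = (1 + z) / (1 - z) := by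
  rw [toStrip, Complex.exp_log]
  exact div_ne_zero (one_add_ne_zero_of_norm_lt hz) (one_sub_ne_zero_of_norm_lt hz)

lemma ofStrip_toStrip {z : ℂ} (hz : ‖z‖ < 1) : ofStrip (toStrip z) = z := by
  have h := one_sub_ne_zero_of_norm_lt hz
  rw [ofStrip, exp_toStrip hz]
  field_simp
  ring_nf

lemma ofStrip_image : ofStrip '' strip = Metric.ball 0 1 := by
  ext z
  simp only [mem_image, mem_ball_zero_iff]
  exact ⟨fun ⟨w, hw, h⟩ => h ▸ norm_ofStrip_lt_one hw,
    fun hz => ⟨toStrip z, toStrip_mem_strip hz, ofStrip_toStrip hz⟩⟩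

lemma injOn_ofStrip : InjOn ofStrip strip := fun w hw w' hw' h => by
  rw [← toStrip_ofStrip hw, h, toStrip_ofStrip hw']

lemma measurableSet_strip : MeasurableSet strip :=
  Complex.measurable_im measurableSet_Ioo

lemma one_sub_sq_ne_zero {z : ℂ} (hz : ‖z‖ < 1) : 1 - z ^ 2 ≠ 0 := by
  have : 1 - z ^ 2 = (1 + z) * (1 - z) := by ring
  rw [this]
  exact mul_ne_zero (one_add_ne_zero_of_norm_lt hz) (one_sub_ne_zero_of_norm_lt hz)

lemma hasDerivAt_ofStrip {w : ℂ} (hw : w ∈ strip) :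
    HasDerivAt ofStrip ((1 - ofStrip w ^ 2) / 2) w := by
  have h := exp_add_one_ne_zero hw
  refine (((Complex.hasDerivAt_exp w).sub_const 1).div
    ((Complex.hasDerivAt_exp w).add_const 1) h).congr_deriv ?_
  unfold ofStrip
  field_simp
  ring

lemma hasDerivAt_toStrip {z : ℂ} (hz : ‖z‖ < 1) :
    HasDerivAt toStrip (2 / (1 - z ^ 2)) z := by
  have h := one_sub_ne_zero_of_norm_lt hz
  have h1 := one_add_ne_zero_of_norm_lt hz
  have h2 := one_sub_sq_ne_zero hz
  have h3 : (1 + z) / (1 - z) ∈ Complex.slitPlane := Or.inl (re_cayley_pos hz)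
  refine ((((hasDerivAt_id z).const_add 1).div ((hasDerivAt_id z).const_sub 1) h).clog
    h3).congr_deriv ?_
  simp only [id, Pi.div_apply]
  field_simp
  ring

/-- The number `|Z'|² = |(1 - Z²) / 2|²`, the Jacobian of `Z = ofStrip`. -/
noncomputable def jac (w : ℂ) : ℝ := ‖(1 - ofStrip w ^ 2) / 2‖ ^ 2

lemma jac_pos {w : ℂ} (hw : w ∈ strip) : 0 < jac w := by
  have := one_sub_sq_ne_zero (norm_ofStrip_lt_one hw)
  exact pow_pos (norm_pos_iff.2 (div_ne_zero this two_ne_zero)) 2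

/-- `|Z'(t + iθ)| = 1 / (cosh t + cos θ)`, which decays exponentially uniformly in `θ`. -/
lemma norm_deriv_ofStrip_le {w : ℂ} (hw : w ∈ strip) :
    ‖(1 - ofStrip w ^ 2) / 2‖ ≤ (Real.cosh w.re)⁻¹ := by
  have h := exp_add_one_ne_zero hw
  have h1 : (1 - ofStrip w ^ 2) / 2 = 2 * Complex.exp w / (Complex.exp w + 1) ^ 2 := by
    unfold ofStrip
    field_simp
    ring
  have h0 := re_exp_pos hw
  have h2 : ‖Complex.exp w + 1‖ ^ 2 ≥ Real.exp w.re ^ 2 + 1 := by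
    rw [← Complex.norm_exp, Complex.sq_norm, Complex.sq_norm, Complex.normSq_apply,
      Complex.normSq_apply]
    simp only [Complex.add_re, Complex.add_im, Complex.one_re, Complex.one_im]
    nlinarith
  rw [h1, norm_div, norm_mul, norm_pow, Complex.norm_exp, Complex.norm_ofNat, Real.cosh_eq,
    Real.exp_neg]
  have h3 := Real.exp_pos w.re
  rw [div_le_iff₀ (by positivity)]
  calc 2 * Real.exp w.re
      = ((Real.exp w.re + (Real.exp w.re)⁻¹) / 2)⁻¹ * (Real.exp w.re ^ 2 + 1) := by
        field_simp
    _ ≤ _ := by gcongr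

lemma abs_det_toSpanSingleton (c : ℂ) :
    |((ContinuousLinearMap.toSpanSingleton ℂ c).restrictScalars ℝ : ℂ →L[ℝ] ℂ).det| = ‖c‖ ^ 2 := by
  have : ((ContinuousLinearMap.toSpanSingleton ℂ c).restrictScalars ℝ : ℂ →L[ℝ] ℂ).det
      = Algebra.norm ℝ c := by
    rw [Algebra.norm_apply, ContinuousLinearMap.det]
    congr 1
    ext; all_goals simp [mul_comm]
  rw [this, Algebra.norm_complex_apply, abs_of_nonneg (Complex.normSq_nonneg _), Complex.sq_norm]

/-- The isometric identification of `ℂ` with the Euclidean plane. -/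
noncomputable def ofComplex : ℂ ≃ₗᵢ[ℝ] Plane := Complex.orthonormalBasisOneI.repr

/-- The parametrisation of the disc by the strip. -/
noncomputable def param (w : ℂ) : Plane := ofComplex (ofStrip w)

/-- The conformal coordinate `t + iθ` on the disc. -/
noncomputable def coord (p : Plane) : ℂ := toStrip (ofComplex.symm p)

lemma norm_ofComplex_symm_lt {p : Plane} (hp : p ∈ disc) : ‖ofComplex.symm p‖ < 1 := by
  simpa [disc] using hp

lemma param_mem_disc {w : ℂ} (hw : w ∈ strip) : param w ∈ disc := by
  simpa [disc, param] using norm_ofStrip_lt_one hw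

lemma coord_param {w : ℂ} (hw : w ∈ strip) : coord (param w) = w := by
  simp [coord, param, toStrip_ofStrip hw]

lemma coord_mem_strip {p : Plane} (hp : p ∈ disc) : coord p ∈ strip :=
  toStrip_mem_strip (norm_ofComplex_symm_lt hp)

lemma ofComplex_preimage_disc : ofComplex ⁻¹' disc = Metric.ball 0 1 := by
  ext z; simp [disc]

lemma measurableSet_disc : MeasurableSet disc := Metric.isOpen_ball.measurableSet

lemma measurePreserving_ofComplex :
    MeasurePreserving ofComplex (volume.restrict (Metric.ball 0 1)) discMeasure := by
  have := ofComplex.measurePreserving.restrict_preimage measurableSet_disc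
  rwa [ofComplex_preimage_disc] at this

lemma measurableEmbedding_ofComplex : MeasurableEmbedding ofComplex :=
  ofComplex.toHomeomorph.measurableEmbedding

/-- Change of variables from the disc to the strip. -/
lemma integral_disc (h : Plane → ℝ) :
    ∫ p, h p ∂discMeasure = ∫ w in strip, jac w * h (param w) := by
  rw [← measurePreserving_ofComplex.integral_comp measurableEmbedding_ofComplex, ← ofStrip_image,
    integral_image_eq_integral_abs_det_fderiv_smul volume measurableSet_strip
      (fun w hw => ((hasDerivAt_ofStrip hw).hasFDerivAt.restrictScalars ℝ).hasFDerivWithinAt)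
      injOn_ofStrip]
  simp only [abs_det_toSpanSingleton, smul_eq_mul]
  rfl

lemma integrable_disc_iff (h : Plane → ℝ) :
    Integrable h discMeasure ↔ IntegrableOn (fun w => jac w * h (param w)) strip := by
  rw [← measurePreserving_ofComplex.integrable_comp_emb measurableEmbedding_ofComplex,
    ← ofStrip_image]
  change IntegrableOn _ _ _ ↔ _
  rw [integrableOn_image_iff_integrableOn_abs_det_fderiv_smul volume measurableSet_strip
      (fun w hw => ((hasDerivAt_ofStrip hw).hasFDerivAt.restrictScalars ℝ).hasFDerivWithinAt)
      injOn_ofStrip]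
  simp only [abs_det_toSpanSingleton, smul_eq_mul]
  rfl

/-! ### Integration over the strip -/

lemma measurePreserving_strip : MeasurePreserving Complex.measurableEquivRealProd
    (volume.restrict strip)
    (volume.prod (volume.restrict (Ioo (-(Real.pi / 2)) (Real.pi / 2)))) := by
  have := Complex.volume_preserving_equiv_real_prod.restrict_preimage
    (s := univ ×ˢ Ioo (-(Real.pi / 2)) (Real.pi / 2)) (MeasurableSet.univ.prod measurableSet_Ioo)
  rw [Measure.volume_eq_prod, ← Measure.prod_restrict, Measure.restrict_univ] at this
  have h : strip = Complex.measurableEquivRealProd ⁻¹'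
      (univ ×ˢ Ioo (-(Real.pi / 2)) (Real.pi / 2)) := by
    ext w
    simp [strip]
  rwa [h]

lemma integrableOn_strip_re {F : ℝ → ℝ} (hF : Integrable F) :
    IntegrableOn (fun w : ℂ => F w.re) strip := by
  have h : Integrable (fun q : ℝ × ℝ => F q.1)
    (volume.prod (volume.restrict (Ioo (-(Real.pi / 2)) (Real.pi / 2)))) := hF.comp_fst _
  exact (measurePreserving_strip.integrable_comp_emb
    Complex.measurableEquivRealProd.measurableEmbedding).2 h

lemma integral_strip_re (F : ℝ → ℝ) :
    ∫ w in strip, F w.re = Real.pi * ∫ t, F t := by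
  have h := measurePreserving_strip.integral_comp
    Complex.measurableEquivRealProd.measurableEmbedding (fun q : ℝ × ℝ => F q.1)
  have h1 := integral_fun_fst (μ := volume)
    (ν := volume.restrict (Ioo (-(Real.pi / 2)) (Real.pi / 2))) F
  rw [h1] at h
  refine h.trans ?_
  have : Real.pi / 2 - -(Real.pi / 2) = Real.pi := by ring
  simp [Measure.real, this, Real.pi_pos.le]

/-- Fubini on the strip, integrating first along the lines `θ = const`. -/
lemma integral_strip {H : ℂ → ℝ} (hH : IntegrableOn H strip) :
    ∫ w in strip, H w = ∫ θ in Ioo (-(Real.pi / 2)) (Real.pi / 2), ∫ t : ℝ, H ⟨t, θ⟩ := by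
  have he := Complex.measurableEquivRealProd.measurableEmbedding
  have h := measurePreserving_strip.integral_comp he (fun q : ℝ × ℝ => H ⟨q.1, q.2⟩)
  refine h.trans (integral_prod_symm _ ?_)
  exact (measurePreserving_strip.integrable_comp_emb he).1 hH

/-! ### Gradients of the conformal coordinates -/

/-- The gradient of `t = Re (toStrip z)`. -/
noncomputable def gradT (p : Plane) : Plane :=
  ofComplex (starRingEnd ℂ (2 / (1 - ofComplex.symm p ^ 2)))

/-- The gradient of `θ = Im (toStrip z)`; by the Cauchy-Riemann equations it is `∇t` turned by a
right angle. -/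
noncomputable def gradTheta (p : Plane) : Plane :=
  ofComplex (Complex.I * starRingEnd ℂ (2 / (1 - ofComplex.symm p ^ 2)))

lemma inner_ofComplex (z : ℂ) (v : Plane) :
    inner ℝ (ofComplex z) v = (starRingEnd ℂ z * ofComplex.symm v).re := by
  conv_lhs => rw [← ofComplex.apply_symm_apply v, LinearIsometryEquiv.inner_map_map]
  simp [Complex.inner, mul_comm]

lemma hasFDerivAt_coord {p : Plane} (hp : p ∈ disc) :
    HasFDerivAt coord (((ContinuousLinearMap.toSpanSingleton ℂ
      (2 / (1 - ofComplex.symm p ^ 2))).restrictScalars ℝ).comp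
        (ofComplex.symm.toContinuousLinearEquiv : Plane →L[ℝ] ℂ)) p :=
  ((hasDerivAt_toStrip (norm_ofComplex_symm_lt hp)).hasFDerivAt.restrictScalars ℝ).comp p
    ofComplex.symm.toContinuousLinearEquiv.hasFDerivAt

lemma hasGradientAt_coord_re {p : Plane} (hp : p ∈ disc) :
    HasGradientAt (fun p => (coord p).re) (gradT p) p := by
  refine (Complex.reCLM.hasFDerivAt.comp p (hasFDerivAt_coord hp)).congr_fderiv ?_
  ext v
  change (ofComplex.symm v * _).re = inner ℝ (gradT p) v
  rw [gradT, inner_ofComplex, Complex.conj_conj, mul_comm]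

lemma hasGradientAt_coord_im {p : Plane} (hp : p ∈ disc) :
    HasGradientAt (fun p => (coord p).im) (gradTheta p) p := by
  refine (Complex.imCLM.hasFDerivAt.comp p (hasFDerivAt_coord hp)).congr_fderiv ?_
  ext v
  change (ofComplex.symm v * _).im = inner ℝ (gradTheta p) v
  rw [gradTheta, inner_ofComplex, map_mul, Complex.conj_conj, Complex.conj_I, mul_comm, mul_assoc]
  simp

lemma perp_ofComplex (z : ℂ) : perp (ofComplex z) = ofComplex (Complex.I * z) := by
  ext i
  fin_cases i <;> simp [perp, ofComplex]

lemma perp_gradT (p : Plane) : perp (gradT p) = gradTheta p := perp_ofComplex _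

lemma perp_gradTheta (p : Plane) : perp (gradTheta p) = -gradT p := by
  rw [gradTheta, perp_ofComplex, ← mul_assoc, Complex.I_mul_I, gradT, neg_one_mul, map_neg]

lemma perp_add (v w : Plane) : perp (v + w) = perp v + perp w := by
  ext i
  fin_cases i <;> simp [perp, add_comm]

lemma perp_smul (c : ℝ) (v : Plane) : perp (c • v) = c • perp v := by
  ext i
  fin_cases i <;> simp [perp]

lemma inner_gradT_gradTheta (p : Plane) : inner ℝ (gradT p) (gradTheta p) = (0 : ℝ) := by
  rw [gradT, gradTheta, inner_ofComplex, LinearIsometryEquiv.symm_apply_apply, Complex.conj_conj,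
    mul_left_comm, Complex.mul_conj]
  simp

lemma norm_gradTheta (p : Plane) : ‖gradTheta p‖ = ‖gradT p‖ := by
  simp [gradTheta, gradT]

lemma norm_gradT_param (w : ℂ) : ‖gradT (param w)‖ = ‖(1 - ofStrip w ^ 2) / 2‖⁻¹ := by
  rw [gradT, param, LinearIsometryEquiv.norm_map, RCLike.norm_conj,
    LinearIsometryEquiv.symm_apply_apply, ← norm_inv, inv_div]

/-- The Dirichlet integrand is conformally invariant: `|Z'|² |∇t|² = 1`. -/
lemma jac_mul_norm_gradT_sq {w : ℂ} (hw : w ∈ strip) : jac w * ‖gradT (param w)‖ ^ 2 = 1 := by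
  rw [norm_gradT_param, inv_pow]
  exact mul_inv_cancel₀ (jac_pos hw).ne'

lemma jac_smul_gradT {w : ℂ} (hw : w ∈ strip) :
    jac w • gradT (param w) = ofComplex ((1 - ofStrip w ^ 2) / 2) := by
  have h := one_sub_sq_ne_zero (norm_ofStrip_lt_one hw)
  have h' : (starRingEnd ℂ) (1 - ofStrip w ^ 2) ≠ 0 := (map_ne_zero _).2 h
  rw [gradT, ← map_smul, param, LinearIsometryEquiv.symm_apply_apply]
  congr 1
  rw [Complex.real_smul, jac, ← Complex.normSq_eq_norm_sq, ← Complex.mul_conj, map_div₀, map_div₀,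
    Complex.conj_ofNat]
  field_simp

lemma param_coord {p : Plane} (hp : p ∈ disc) : param (coord p) = p := by
  simp [param, coord, ofStrip_toStrip (norm_ofComplex_symm_lt hp)]

lemma cosh_le_norm_gradT {p : Plane} (hp : p ∈ disc) : Real.cosh (coord p).re ≤ ‖gradT p‖ := by
  have hs := coord_mem_strip hp
  have h := norm_deriv_ofStrip_le hs
  have h0 := one_sub_sq_ne_zero (norm_ofStrip_lt_one hs)
  rw [← param_coord hp, norm_gradT_param, coord_param hs]
  rw [le_inv_comm₀ (Real.cosh_pos _) (norm_pos_iff.2 (div_ne_zero h0 two_ne_zero))]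
  exact h

lemma continuousOn_coord : ContinuousOn coord disc := fun _ hp =>
  (hasFDerivAt_coord hp).continuousAt.continuousWithinAt

lemma continuousOn_gradT : ContinuousOn gradT disc := by
  unfold gradT
  refine ofComplex.continuous.comp_continuousOn (Complex.continuous_conj.comp_continuousOn ?_)
  refine continuousOn_const.div (by fun_prop) fun p hp => ?_
  exact one_sub_sq_ne_zero (norm_ofComplex_symm_lt hp)

lemma continuousOn_gradTheta : ContinuousOn gradTheta disc := by
  unfold gradTheta
  refine ofComplex.continuous.comp_continuousOn (continuousOn_const.mul
    (Complex.continuous_conj.comp_continuousOn ?_))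
  refine continuousOn_const.div (by fun_prop) fun p hp => ?_
  exact one_sub_sq_ne_zero (norm_ofComplex_symm_lt hp)

lemma aestronglyMeasurable_disc {E : Type*} [TopologicalSpace E]
    [TopologicalSpace.PseudoMetrizableSpace E] [SecondCountableTopology E]
    {V : Plane → E} (hV : ContinuousOn V disc) :
    AEStronglyMeasurable V discMeasure :=
  hV.aestronglyMeasurable measurableSet_disc

lemma ae_mem_disc : ∀ᵐ p ∂discMeasure, p ∈ disc := ae_restrict_mem measurableSet_disc

instance : IsFiniteMeasure discMeasure :=
  ⟨by rw [discMeasure, Measure.restrict_apply_univ]; exact measure_ball_lt_top⟩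

/-! ### Integrability on the disc -/

lemma integrable_coord_mul {F : ℝ → ℝ} (hF : Integrable F) :
    Integrable (fun p => F (coord p).re * ‖gradT p‖ ^ 2) discMeasure := by
  rw [integrable_disc_iff]
  refine (integrableOn_strip_re hF).congr_fun (fun w hw => ?_) measurableSet_strip
  simp only [coord_param hw]
  linear_combination (-F w.re) * jac_mul_norm_gradT_sq hw

lemma integral_coord_mul (F : ℝ → ℝ) :
    ∫ p, F (coord p).re * ‖gradT p‖ ^ 2 ∂discMeasure = Real.pi * ∫ t, F t := by
  rw [integral_disc, ← integral_strip_re]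
  refine setIntegral_congr_fun measurableSet_strip fun w hw => ?_
  simp only [coord_param hw]
  linear_combination (F w.re) * jac_mul_norm_gradT_sq hw

lemma memLp_two_of_norm_sq_le {V : Plane → Plane} (hV : ContinuousOn V disc) {F : ℝ → ℝ}
    (hF : Integrable F) (h : ∀ p ∈ disc, ‖V p‖ ^ 2 ≤ F (coord p).re * ‖gradT p‖ ^ 2) :
    MemLp V 2 discMeasure := by
  have hm := aestronglyMeasurable_disc hV
  rw [memLp_two_iff_integrable_sq_norm hm]
  refine (integrable_coord_mul hF).mono' (hm.norm.pow 2) ?_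
  filter_upwards [ae_mem_disc] with p hp
  rw [Real.norm_of_nonneg (by positivity)]
  exact h p hp

lemma integrable_inv_cosh : Integrable (fun t => (Real.cosh t)⁻¹) := by
  refine (integrable_inv_one_add_sq.const_mul 2).mono'
    (Real.continuous_cosh.inv₀ fun t => (Real.cosh_pos t).ne').aestronglyMeasurable ?_
  refine Eventually.of_forall fun t => ?_
  have h : (1 + t ^ 2) / 2 ≤ Real.cosh t := by
    have h1 : Real.cosh t = 1 + 2 * Real.sinh (t / 2) ^ 2 := by
      have h2 := Real.cosh_two_mul (t / 2)
      rw [mul_div_cancel₀ t two_ne_zero] at h2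
      rw [h2, Real.cosh_sq]
      ring
    have h2 : |t / 2| ≤ |Real.sinh (t / 2)| := by
      rw [Real.abs_sinh]
      exact Real.self_le_sinh_iff.2 (abs_nonneg _)
    have h3 := sq_le_sq.2 h2
    nlinarith
  rw [Real.norm_of_nonneg (inv_nonneg.2 (Real.cosh_pos t).le), ← div_eq_mul_inv,
    inv_le_comm₀ (Real.cosh_pos t) (by positivity), inv_div]
  exact h

lemma integrable_norm_gradT : Integrable (fun p => ‖gradT p‖) discMeasure := by
  rw [integrable_disc_iff]
  have hm : IntegrableOn (fun w : ℂ => (Real.cosh w.re)⁻¹) strip :=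
    integrableOn_strip_re integrable_inv_cosh
  have hc : ContinuousOn ofStrip strip := fun w hw =>
    (hasDerivAt_ofStrip hw).continuousAt.continuousWithinAt
  have hc2 : ContinuousOn (fun w => ‖(1 - ofStrip w ^ 2) / 2‖) strip := by fun_prop
  have he : EqOn (fun w => ‖(1 - ofStrip w ^ 2) / 2‖) (fun w => jac w * ‖gradT (param w)‖)
      strip := fun w hw => by
    have h0 := one_sub_sq_ne_zero (norm_ofStrip_lt_one hw)
    have h1 := norm_pos_iff.2 (div_ne_zero h0 (two_ne_zero (α := ℂ)))
    simp only [norm_gradT_param, jac]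
    field_simp
  refine IntegrableOn.congr_fun ?_ he measurableSet_strip
  refine Integrable.mono' hm (hc2.aestronglyMeasurable measurableSet_strip) ?_
  filter_upwards [ae_restrict_mem measurableSet_strip] with w hw
  rw [norm_norm]
  exact norm_deriv_ofStrip_le hw

/-! ### Weak gradients -/

/-- A function that is differentiable in the open disc has its classical gradient as weak gradient,
whatever its behaviour at the boundary. -/
lemma HasWeakGradient.of_hasGradientAt {q : ℝ≥0∞} (hq : 1 ≤ q) {u : Plane → ℝ} {G : Plane → Plane}
    (h : ∀ x ∈ disc, HasGradientAt u (G x) x) (hu : MemLp u q discMeasure)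
    (hG : MemLp G q discMeasure) : HasWeakGradient q u G := by
  refine ⟨hu, hG, fun ξ hξ hc hs i => ?_⟩
  have hui : Integrable u discMeasure := hu.integrable hq
  have hGi : Integrable (fun x => G x i) discMeasure :=
    (EuclideanSpace.proj (𝕜 := ℝ) i).integrable_comp (hG.integrable hq)
  have hξ' : Continuous (partialDeriv i ξ) := by
    unfold partialDeriv
    exact (hξ.continuous_fderiv (by simp)).clm_apply continuous_const
  have hc' : HasCompactSupport (partialDeriv i ξ) := hc.fderiv_apply (𝕜 := ℝ) _
  obtain ⟨M, hM⟩ := hξ.continuous.bounded_above_of_compact_support hc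
  obtain ⟨M', hM'⟩ := hξ'.bounded_above_of_compact_support hc'
  have i1 : Integrable (fun x => u x * partialDeriv i ξ x) discMeasure :=
    hui.mul_bdd hξ'.aestronglyMeasurable (Eventually.of_forall hM')
  have i2 : Integrable (fun x => G x i * ξ x) discMeasure :=
    hGi.mul_bdd hξ.continuous.aestronglyMeasurable (Eventually.of_forall hM)
  have i3 : Integrable (fun x => u x * ξ x) discMeasure :=
    hui.mul_bdd hξ.continuous.aestronglyMeasurable (Eventually.of_forall hM)
  have z0 : ∀ x, x ∉ disc → ξ x = 0 := fun x hx => image_eq_zero_of_notMem_tsupport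
    fun hx' => hx (hs hx')
  have z1 : ∀ x, x ∉ disc → partialDeriv i ξ x = 0 := fun x hx => by
    have : fderiv ℝ ξ x = 0 := by
      by_contra h0
      exact hx (hs (support_fderiv_subset ℝ h0))
    simp [partialDeriv, this]
  have hd : ∀ x, HasLineDerivAt ℝ (fun x => u x * ξ x)
      (u x * partialDeriv i ξ x + G x i * ξ x) x (EuclideanSpace.single i 1) := fun x => by
    by_cases hx : x ∈ disc
    · have h1 := ((h x hx).hasFDerivAt.mul
        ((hξ.differentiable (by simp)) x).hasFDerivAt).hasLineDerivAt (EuclideanSpace.single i 1)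
      refine h1.congr_deriv ?_
      simp [partialDeriv, mul_comm, EuclideanSpace.inner_single_right]
    · have hx' : x ∉ tsupport ξ := fun h' => hx (hs h')
      have h1 : HasFDerivAt (fun x => u x * ξ x) (0 : Plane →L[ℝ] ℝ) x := by
        refine (hasFDerivAt_const (0 : ℝ) x).congr_of_eventuallyEq ?_
        filter_upwards [notMem_tsupport_iff_eventuallyEq.1 hx'] with y hy
        simp [hy]
      refine (h1.hasLineDerivAt (EuclideanSpace.single i 1)).congr_deriv ?_
      simp [z0 x hx, z1 x hx]
  have e : ∀ {f : Plane → ℝ}, (∀ x, x ∉ disc → f x = 0) → Integrable f discMeasure →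
      Integrable f := fun {f} hf hi => by
    refine IntegrableOn.integrable_of_forall_notMem_eq_zero (s := disc) hi hf
  have j1 := e (f := fun x => u x * partialDeriv i ξ x + G x i * ξ x)
    (fun x hx => by simp [z0 x hx, z1 x hx]) (i1.add i2)
  have j2 := e (fun x hx => by simp [z0 x hx]) i3
  -- Integrating the derivative of the compactly supported function `u * ξ` gives zero.
  have key := integral_bilinear_hasLineDerivAt_right_eq_neg_left_of_integrable
    (μ := (volume : Measure Plane)) (B := ContinuousLinearMap.mul ℝ ℝ) (g := fun _ => (1 : ℝ))
    (g' := fun _ => 0) (f := fun x => u x * ξ x)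
    (f' := fun x => u x * partialDeriv i ξ x + G x i * ξ x) (v := EuclideanSpace.single i 1)
    (by simpa using j1) (by simp) (by simpa using j2) (fun x _ => hd x)
    (fun x _ => (hasFDerivAt_const (1 : ℝ) x).hasLineDerivAt _)
  simp only [ContinuousLinearMap.mul_apply', mul_zero, integral_zero, mul_one] at key
  have key2 := setIntegral_eq_integral_of_forall_compl_eq_zero (μ := (volume : Measure Plane))
    (s := disc) (f := fun x => u x * partialDeriv i ξ x + G x i * ξ x)
    (fun x hx => by simp [z0 x hx, z1 x hx])
  have key3 := integral_add i1 i2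
  change ∫ x, u x * partialDeriv i ξ x + G x i * ξ x ∂discMeasure = _ at key2
  linarith

lemma HasWeakGradient.ae_eq {q r : ℝ≥0∞} (hq : 1 ≤ q) (hr : 1 ≤ r) {u : Plane → ℝ}
    {G H : Plane → Plane} (hG : HasWeakGradient q u G) (hH : HasWeakGradient r u H) :
    G =ᵐ[discMeasure] H := by
  have hGi := hG.memLp_grad.integrable hq
  have hHi := hH.memLp_grad.integrable hr
  have key : ∀ i : Fin 2, ∀ᵐ x ∂(volume : Measure Plane), x ∈ disc → G x i - H x i = 0 := by
    intro i
    have iG : Integrable (fun x => G x i) discMeasure :=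
      (EuclideanSpace.proj (𝕜 := ℝ) i).integrable_comp hGi
    have iH : Integrable (fun x => H x i) discMeasure :=
      (EuclideanSpace.proj (𝕜 := ℝ) i).integrable_comp hHi
    have hi : IntegrableOn (fun x => G x i - H x i) disc := iG.sub iH
    refine Metric.isOpen_ball.ae_eq_zero_of_integral_contDiff_smul_eq_zero
      hi.locallyIntegrableOn fun ξ hξ hc hs => ?_
    obtain ⟨M, hM⟩ := hξ.continuous.bounded_above_of_compact_support hc
    rw [← setIntegral_eq_integral_of_forall_compl_eq_zero (s := disc)
      (fun x hx => by rw [image_eq_zero_of_notMem_tsupport fun hx' => hx (hs hx'), zero_smul])]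
    have e1 := hG.integral_eq ξ hξ hc hs i
    have e2 := hH.integral_eq ξ hξ hc hs i
    have e3 := integral_sub
      (iG.mul_bdd hξ.continuous.aestronglyMeasurable (Eventually.of_forall hM))
      (iH.mul_bdd hξ.continuous.aestronglyMeasurable (Eventually.of_forall hM))
    change ∫ x, ξ x • (G x i - H x i) ∂discMeasure = 0
    calc _ = ∫ x, (G x i * ξ x - H x i * ξ x) ∂discMeasure := by
          congr 1; ext x; rw [smul_eq_mul]; ring
      _ = 0 := by rw [e3]; linarith
  have h2 := (ae_all_iff.2 key)
  filter_upwards [ae_restrict_of_ae h2, ae_mem_disc] with x hx hxd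
  ext i
  exact sub_eq_zero.1 (hx i hxd)

/-! ### Functions of the coordinate `t` alone -/

lemma sum_mul_partialDeriv (v : Plane) (ζ : Plane → ℝ) (x : Plane) :
    ∑ i : Fin 2, v i * partialDeriv i ζ x = fderiv ℝ ζ x v := by
  conv_rhs => rw [← (EuclideanSpace.basisFun (Fin 2) ℝ).sum_repr v, map_sum]
  simp [partialDeriv]

lemma mk_eq_ofReal_add (θ : ℝ) :
    (fun t : ℝ => (⟨t, θ⟩ : ℂ)) = fun t : ℝ => (t : ℂ) + θ * Complex.I := by
  ext t
  apply Complex.ext <;> simp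

lemma hasDerivAt_comp_param {ζ : Plane → ℝ} (hζ : Differentiable ℝ ζ) {t θ : ℝ}
    (hw : (⟨t, θ⟩ : ℂ) ∈ strip) :
    HasDerivAt (fun s : ℝ => ζ (param ⟨s, θ⟩))
      (fderiv ℝ ζ (param ⟨t, θ⟩) (ofComplex ((1 - ofStrip ⟨t, θ⟩ ^ 2) / 2))) t := by
  have h1 : HasDerivAt (fun s : ℝ => (⟨s, θ⟩ : ℂ)) 1 t := by
    rw [mk_eq_ofReal_add]
    simpa using (Complex.ofRealCLM.hasDerivAt (x := t)).add_const (θ * Complex.I)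
  have h2 := (hasDerivAt_ofStrip hw).comp t h1
  rw [mul_one] at h2
  have h3 := ofComplex.toContinuousLinearEquiv.hasFDerivAt.comp_hasDerivAt t h2
  exact (hζ _).hasFDerivAt.comp_hasDerivAt t h3

/-- If `φ' = g`, then `φ(t)` solves `div (∇φ) = g'(t) |∇t|²` with zero normal derivative, as the
lines `θ = const` are orthogonal to the boundary of the strip. The identity is the integration by
parts along these lines. -/
lemma integral_mul_fderiv_gradT {g g' : ℝ → ℝ} (hg : ∀ t, HasDerivAt g (g' t) t) {C : ℝ}
    (hC : ∀ t, |g t| ≤ C) (hbot : Tendsto g atBot (𝓝 0)) (htop : Tendsto g atTop (𝓝 0))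
    (hcont : Continuous g') (hint : Integrable g') {ζ : Plane → ℝ} (hζ : ContDiff ℝ ∞ ζ) :
    ∫ p, g (coord p).re * fderiv ℝ ζ p (gradT p) ∂discMeasure
      = -∫ p, g' (coord p).re * ‖gradT p‖ ^ 2 * ζ p ∂discMeasure := by
  have hζ' : Continuous (fderiv ℝ ζ) := hζ.continuous_fderiv (by simp)
  have hK : IsCompact (Metric.closedBall (0 : Plane) 1) := isCompact_closedBall 0 1
  obtain ⟨M, hM⟩ := hK.exists_bound_of_continuousOn hζ.continuous.continuousOn
  obtain ⟨M', hM'⟩ := hK.exists_bound_of_continuousOn hζ'.continuousOn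
  have hmem : ∀ {w : ℂ}, w ∈ strip → param w ∈ Metric.closedBall (0 : Plane) 1 := fun hw =>
    Metric.ball_subset_closedBall (param_mem_disc hw)
  have hgc : Continuous g := continuous_iff_continuousAt.2 fun t => (hg t).continuousAt
  have hc0 : ContinuousOn ofStrip strip := fun w hw =>
    (hasDerivAt_ofStrip hw).continuousAt.continuousWithinAt
  have hc1 : ContinuousOn param strip := ofComplex.continuous.comp_continuousOn hc0
  set D : ℂ → ℝ := fun w => fderiv ℝ ζ (param w) (ofComplex ((1 - ofStrip w ^ 2) / 2)) with hD
  have hDc : ContinuousOn D strip := (hζ'.comp_continuousOn hc1).clm_apply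
    (ofComplex.continuous.comp_continuousOn (by fun_prop))
  have hDb : ∀ w ∈ strip, ‖D w‖ ≤ M' * (Real.cosh w.re)⁻¹ := fun w hw => by
    refine ((fderiv ℝ ζ (param w)).le_opNorm _).trans ?_
    rw [LinearIsometryEquiv.norm_map]
    have h1 := hM' _ (hmem hw)
    exact mul_le_mul h1 (norm_deriv_ofStrip_le hw) (norm_nonneg _) ((norm_nonneg _).trans h1)
  have hb1 : ∀ w ∈ strip, ‖g w.re * D w‖ ≤ C * (M' * (Real.cosh w.re)⁻¹) := fun w hw => by
    rw [norm_mul]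
    exact mul_le_mul (hC _) (hDb w hw) (norm_nonneg _) ((abs_nonneg _).trans (hC 0))
  have hb2 : ∀ w ∈ strip, ‖g' w.re * ζ (param w)‖ ≤ ‖g' w.re‖ * M := fun w hw => by
    rw [norm_mul]
    exact mul_le_mul_of_nonneg_left (hM _ (hmem hw)) (norm_nonneg _)
  have hc2 : ContinuousOn (fun w => g w.re * D w) strip :=
    (hgc.comp Complex.continuous_re).continuousOn.mul hDc
  have hc3 : ContinuousOn (fun w => g' w.re * ζ (param w)) strip :=
    (hcont.comp Complex.continuous_re).continuousOn.mul (hζ.continuous.comp_continuousOn hc1)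
  have k1 : Integrable (fun t => C * (M' * (Real.cosh t)⁻¹)) :=
    (integrable_inv_cosh.const_mul M').const_mul C
  have k2 : Integrable (fun t => ‖g' t‖ * M) := hint.norm.mul_const M
  have i1 : IntegrableOn (fun w => g w.re * D w) strip := by
    refine Integrable.mono' (integrableOn_strip_re k1)
      (hc2.aestronglyMeasurable measurableSet_strip) ?_
    filter_upwards [ae_restrict_mem measurableSet_strip] with w hw using hb1 w hw
  have i2 : IntegrableOn (fun w => g' w.re * ζ (param w)) strip := by
    refine Integrable.mono' (integrableOn_strip_re k2)
      (hc3.aestronglyMeasurable measurableSet_strip) ?_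
    filter_upwards [ae_restrict_mem measurableSet_strip] with w hw using hb2 w hw
  have l1 : ∫ p, g (coord p).re * fderiv ℝ ζ p (gradT p) ∂discMeasure
      = ∫ w in strip, g w.re * D w := by
    rw [integral_disc]
    refine setIntegral_congr_fun measurableSet_strip fun w hw => ?_
    simp only [coord_param hw, hD, ← jac_smul_gradT hw, map_smul, smul_eq_mul]
    ring
  have l2 : ∫ p, g' (coord p).re * ‖gradT p‖ ^ 2 * ζ p ∂discMeasure
      = ∫ w in strip, g' w.re * ζ (param w) := by
    rw [integral_disc]
    refine setIntegral_congr_fun measurableSet_strip fun w hw => ?_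
    simp only [coord_param hw]
    linear_combination (g' w.re * ζ (param w)) * jac_mul_norm_gradT_sq hw
  rw [l1, l2, integral_strip i1, integral_strip i2, ← integral_neg]
  refine setIntegral_congr_fun measurableSet_Ioo fun θ hθ => ?_
  have hs : ∀ t : ℝ, (⟨t, θ⟩ : ℂ) ∈ strip := fun t => hθ
  have hline : Continuous fun t : ℝ => (⟨t, θ⟩ : ℂ) := by
    rw [mk_eq_ofReal_add]
    fun_prop
  have hz : ∀ {f : ℝ → ℝ} {l : Filter ℝ}, Tendsto f l (𝓝 0) →
      Tendsto (f * fun t => ζ (param ⟨t, θ⟩)) l (𝓝 0) := fun {f l} hf => by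
    refine squeeze_zero_norm (a := fun t => ‖f t‖ * M) (fun t => ?_) ?_
    · rw [Pi.mul_apply, norm_mul]
      exact mul_le_mul_of_nonneg_left (hM _ (hmem (hs t))) (norm_nonneg _)
    · simpa using hf.norm.mul_const M
  have ibp := integral_mul_deriv_eq_deriv_mul (u := g) (u' := g')
    (v := fun t => ζ (param ⟨t, θ⟩)) (v' := fun t => D ⟨t, θ⟩)
    (fun t _ => hg t) (fun t _ => hasDerivAt_comp_param (hζ.differentiable (by simp)) (hs t))
    (k1.mono' (hc2.comp_continuous hline hs).aestronglyMeasurable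
      (Eventually.of_forall fun t => hb1 _ (hs t)))
    (k2.mono' (hc3.comp_continuous hline hs).aestronglyMeasurable
      (Eventually.of_forall fun t => hb2 _ (hs t)))
    (hz hbot) (hz htop)
  simpa using ibp

/-! ### The one-dimensional profiles -/

/-- The Japanese bracket `√(1 + t²)`. -/
noncomputable def bracket (t : ℝ) : ℝ := √(1 + t ^ 2)

lemma bracket_pos (t : ℝ) : 0 < bracket t := Real.sqrt_pos.2 (by positivity)

lemma bracket_sq (t : ℝ) : bracket t ^ 2 = 1 + t ^ 2 := Real.sq_sqrt (by positivity)

lemma one_le_bracket (t : ℝ) : 1 ≤ bracket t := Real.one_le_sqrt.2 (by nlinarith [sq_nonneg t])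

lemma abs_le_bracket (t : ℝ) : |t| ≤ bracket t := Real.abs_le_sqrt (by linarith)

lemma abs_div_bracket_le (t : ℝ) : |t / bracket t| ≤ 1 := by
  rw [abs_div, abs_of_pos (bracket_pos t)]
  exact div_le_one_of_le₀ (abs_le_bracket t) (bracket_pos t).le

lemma contDiff_bracket : ContDiff ℝ ∞ bracket :=
  ContDiff.sqrt (by fun_prop) fun t => by positivity

lemma continuous_bracket : Continuous bracket := contDiff_bracket.continuous

lemma hasDerivAt_bracket (t : ℝ) : HasDerivAt bracket (t / bracket t) t := by
  have h := (((hasDerivAt_id t).pow 2).const_add 1).sqrt (by change (1 : ℝ) + t ^ 2 ≠ 0; positivity)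
  refine h.congr_deriv ?_
  simp only [id, Pi.pow_apply, bracket]
  field_simp
  simp

/-- The amplitude `(1 + t²)^(-3/8)`; it is square integrable. -/
noncomputable def amp (t : ℝ) : ℝ := bracket t ^ (-(3 / 4) : ℝ)

/-- The function `(1 + t²)^(-1/4)`; it tends to zero but is not square integrable. -/
noncomputable def tail (t : ℝ) : ℝ := bracket t ^ (-(1 / 2) : ℝ)

lemma amp_pos (t : ℝ) : 0 < amp t := Real.rpow_pos_of_pos (bracket_pos t) _

lemma tail_pos (t : ℝ) : 0 < tail t := Real.rpow_pos_of_pos (bracket_pos t) _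

lemma amp_le_one (t : ℝ) : amp t ≤ 1 :=
  Real.rpow_le_one_of_one_le_of_nonpos (one_le_bracket t) (by norm_num)

lemma tail_le_one (t : ℝ) : tail t ≤ 1 :=
  Real.rpow_le_one_of_one_le_of_nonpos (one_le_bracket t) (by norm_num)

lemma contDiff_tail : ContDiff ℝ ∞ tail :=
  contDiff_bracket.rpow_const_of_ne fun t => (bracket_pos t).ne'

lemma continuous_amp : Continuous amp :=
  continuous_bracket.rpow_const fun t => Or.inl (bracket_pos t).ne'

lemma amp_sq_mul_bracket (t : ℝ) : amp t ^ 2 * bracket t = tail t := by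
  have h := bracket_pos t
  rw [amp, tail, ← Real.rpow_natCast, ← Real.rpow_mul h.le, ← Real.rpow_add_one h.ne']
  norm_num

lemma tail_sq (t : ℝ) : tail t ^ 2 = (bracket t)⁻¹ := by
  have h := bracket_pos t
  rw [tail, ← Real.rpow_natCast, ← Real.rpow_mul h.le, ← Real.rpow_neg_one]
  norm_num

lemma amp_sq_le_tail (t : ℝ) : amp t ^ 2 ≤ tail t := by
  rw [← amp_sq_mul_bracket]
  exact le_mul_of_one_le_right (sq_nonneg _) (one_le_bracket t)

lemma integrable_amp_sq : Integrable fun t => amp t ^ 2 := by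
  have h := integrable_rpow_neg_one_add_norm_sq (E := ℝ) (μ := volume) (r := 3 / 2)
    (by simp; norm_num)
  convert h using 2 with t
  rw [Real.norm_eq_abs, sq_abs, ← bracket_sq, amp, ← Real.rpow_natCast, ← Real.rpow_natCast,
    ← Real.rpow_mul (bracket_pos t).le, ← Real.rpow_mul (bracket_pos t).le]
  norm_num

lemma hasDerivAt_amp (t : ℝ) :
    HasDerivAt amp (-(3 / 4) * (t / bracket t) * amp t * (bracket t)⁻¹) t := by
  have h := bracket_pos t
  refine ((hasDerivAt_bracket t).rpow_const (p := -(3 / 4)) (Or.inl h.ne')).congr_deriv ?_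
  rw [Real.rpow_sub_one h.ne', amp]
  ring

/-- The profile of `a`. -/
noncomputable def profA (t : ℝ) : ℝ := amp t * Real.sin (bracket t)

/-- The profile of `b`. -/
noncomputable def profB (t : ℝ) : ℝ := amp t * Real.cos (bracket t)

/-- The derivative of `profA`. -/
noncomputable def profA' (t : ℝ) : ℝ :=
  amp t * (t / bracket t * (Real.cos (bracket t) - 3 / 4 * (bracket t)⁻¹ * Real.sin (bracket t)))

/-- The derivative of `profB`. -/
noncomputable def profB' (t : ℝ) : ℝ :=
  amp t * (t / bracket t * (-Real.sin (bracket t) - 3 / 4 * (bracket t)⁻¹ * Real.cos (bracket t)))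

/-- The flux `φ'(t)`, an antiderivative of `profA' * profB`. -/
noncomputable def flux (t : ℝ) : ℝ :=
  amp t ^ 2 * (-bracket t + Real.sin (bracket t) * Real.cos (bracket t) / 2)

lemma hasDerivAt_profA (t : ℝ) : HasDerivAt profA (profA' t) t := by
  refine ((hasDerivAt_amp t).mul (hasDerivAt_bracket t).sin).congr_deriv ?_
  rw [profA']
  ring

lemma hasDerivAt_profB (t : ℝ) : HasDerivAt profB (profB' t) t := by
  refine ((hasDerivAt_amp t).mul (hasDerivAt_bracket t).cos).congr_deriv ?_
  rw [profB']
  ring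

/-- With `J = bracket` and `ρ = amp`, one has
`2 (ρ sin J)' ρ cos J = J' ρ² + (ρ² sin (2 J))' / 2`. The first term integrates to `-2 J^(-1/2)`,
which is not square integrable, and the second to a quantity of smaller order. -/
lemma hasDerivAt_flux (t : ℝ) : HasDerivAt flux (profA' t * profB t) t := by
  have h := bracket_pos t
  have hJ := hasDerivAt_bracket t
  refine (((hasDerivAt_amp t).pow 2).mul (hJ.neg.add ((hJ.sin.mul hJ.cos).div_const 2))).congr_deriv
    ?_
  simp only [Pi.pow_apply, Pi.add_apply, Pi.neg_apply, Pi.mul_apply, profA', profB, Nat.cast_ofNat]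
  have hs := Real.sin_sq_add_cos_sq (bracket t)
  field_simp
  linear_combination (-4 * t * amp t ^ 2 * bracket t) * hs

lemma continuous_profA' : Continuous profA' := by
  have := continuous_bracket
  have := continuous_amp
  have h0 : ∀ t, bracket t ≠ 0 := fun t => (bracket_pos t).ne'
  unfold profA'
  fun_prop (disch := assumption)

lemma continuous_profB' : Continuous profB' := by
  have := continuous_bracket
  have := continuous_amp
  have h0 : ∀ t, bracket t ≠ 0 := fun t => (bracket_pos t).ne'
  unfold profB'
  fun_prop (disch := assumption)

lemma continuous_profA : Continuous profA :=
  continuous_amp.mul (Real.continuous_sin.comp continuous_bracket)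

lemma continuous_profB : Continuous profB :=
  continuous_amp.mul (Real.continuous_cos.comp continuous_bracket)

lemma continuous_flux : Continuous flux :=
  continuous_iff_continuousAt.2 fun t => (hasDerivAt_flux t).continuousAt

lemma abs_profA_le (t : ℝ) : |profA t| ≤ amp t := by
  rw [profA, abs_mul, abs_of_pos (amp_pos t)]
  exact mul_le_of_le_one_right (amp_pos t).le (Real.abs_sin_le_one _)

lemma abs_profB_le (t : ℝ) : |profB t| ≤ amp t := by
  rw [profB, abs_mul, abs_of_pos (amp_pos t)]
  exact mul_le_of_le_one_right (amp_pos t).le (Real.abs_cos_le_one _)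

lemma abs_slope_le (t : ℝ) {x y : ℝ} (hx : |x| ≤ 1) (hy : |y| ≤ 1) :
    |amp t * (t / bracket t * (x - 3 / 4 * (bracket t)⁻¹ * y))| ≤ 2 * amp t := by
  have h1 : |(bracket t)⁻¹ * y| ≤ 1 := by
    rw [abs_mul, abs_inv, abs_of_pos (bracket_pos t)]
    exact mul_le_one₀ (inv_le_one_of_one_le₀ (one_le_bracket t)) (abs_nonneg _) hy
  have h2 : |x - 3 / 4 * (bracket t)⁻¹ * y| ≤ 2 := by
    rw [abs_le] at *
    constructor <;> linarith [h1.1, h1.2, hx.1, hx.2]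
  rw [abs_mul, abs_mul, abs_of_pos (amp_pos t), mul_comm]
  refine mul_le_mul_of_nonneg_right ?_ (amp_pos t).le
  calc _ ≤ 1 * (2 : ℝ) := mul_le_mul (abs_div_bracket_le t) h2 (abs_nonneg _) zero_le_one
    _ = 2 := one_mul 2

lemma abs_profA'_le (t : ℝ) : |profA' t| ≤ 2 * amp t :=
  abs_slope_le t (Real.abs_cos_le_one _) (Real.abs_sin_le_one _)

lemma abs_profB'_le (t : ℝ) : |profB' t| ≤ 2 * amp t :=
  abs_slope_le t (by rw [abs_neg]; exact Real.abs_sin_le_one _) (Real.abs_cos_le_one _)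

lemma integrable_profA'_mul_profB : Integrable fun t => profA' t * profB t := by
  refine (integrable_amp_sq.const_mul 2).mono'
    (continuous_profA'.mul continuous_profB).aestronglyMeasurable (Eventually.of_forall fun t => ?_)
  rw [Real.norm_eq_abs, abs_mul]
  calc _ ≤ (2 * amp t) * amp t := mul_le_mul (abs_profA'_le t) (abs_profB_le t) (abs_nonneg _)
        (mul_nonneg zero_le_two (amp_pos t).le)
    _ = _ := by ring

lemma abs_sin_mul_cos_le (x : ℝ) : |Real.sin x * Real.cos x| ≤ 1 / 2 := by
  have h := Real.sin_sq_add_cos_sq x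
  rw [abs_le]
  constructor <;> nlinarith [sq_nonneg (Real.sin x + Real.cos x),
    sq_nonneg (Real.sin x - Real.cos x)]

lemma flux_eq (t : ℝ) :
    flux t = -tail t + amp t ^ 2 * (Real.sin (bracket t) * Real.cos (bracket t)) / 2 := by
  rw [flux, ← amp_sq_mul_bracket]
  ring

lemma abs_flux_add_tail_le (t : ℝ) : |flux t + tail t| ≤ tail t / 4 := by
  have h : flux t + tail t = amp t ^ 2 * (Real.sin (bracket t) * Real.cos (bracket t)) / 2 := by
    rw [flux_eq]; ring
  rw [h, abs_div, abs_mul, abs_of_nonneg (sq_nonneg (amp t)), abs_two]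
  have h1 := mul_le_mul (amp_sq_le_tail t) (abs_sin_mul_cos_le (bracket t)) (abs_nonneg _)
    (tail_pos t).le
  linarith

lemma abs_flux_le (t : ℝ) : |flux t| ≤ 2 * tail t := by
  have h := abs_le.1 (abs_flux_add_tail_le t)
  have := tail_pos t
  rw [abs_le]
  constructor <;> linarith [h.1, h.2]

lemma flux_le (t : ℝ) : flux t ≤ -(3 / 4) * tail t := by
  linarith [(abs_le.1 (abs_flux_add_tail_le t)).2]

lemma tendsto_flux {l : Filter ℝ} (hl : Tendsto (fun t : ℝ => |t|) l atTop) :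
    Tendsto flux l (𝓝 0) := by
  have h1 : Tendsto bracket l atTop := tendsto_atTop_mono abs_le_bracket hl
  have h2 : Tendsto tail l (𝓝 0) := (tendsto_rpow_neg_atTop (y := 1 / 2) (by norm_num)).comp h1
  refine squeeze_zero_norm (a := fun t => 2 * tail t) abs_flux_le ?_
  simpa using h2.const_mul 2

lemma not_integrable_inv_bracket : ¬ Integrable fun t => (bracket t)⁻¹ := by
  intro h
  refine not_integrableOn_Ioi_inv (a := 1) ?_
  refine Integrable.mono' (h.integrableOn.const_mul 2)
    measurable_inv.aestronglyMeasurable ?_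
  filter_upwards [ae_restrict_mem measurableSet_Ioi] with t ht
  have ht : (1 : ℝ) < t := ht
  have h0 : 0 < t := by linarith
  have hb : bracket t ≤ 2 * t := Real.sqrt_le_iff.2 ⟨by linarith, by nlinarith⟩
  rw [Real.norm_of_nonneg (inv_nonneg.2 h0.le), ← div_eq_mul_inv,
    inv_le_comm₀ h0 (div_pos two_pos (bracket_pos t)), inv_div]
  linarith

/-! ### Test functions -/

lemma hasDerivAt_tanh (t : ℝ) : HasDerivAt Real.tanh (1 - Real.tanh t ^ 2) t := by
  have h := (Real.cosh_pos t).ne'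
  have e : Real.tanh = fun t => Real.sinh t / Real.cosh t := by
    ext t; exact Real.tanh_eq_sinh_div_cosh t
  rw [e]
  refine ((Real.hasDerivAt_sinh t).div (Real.hasDerivAt_cosh t) h).congr_deriv ?_
  field_simp

lemma contDiffAt_artanh {x : ℝ} (hx : x ∈ Ioo (-1 : ℝ) 1) : ContDiffAt ℝ ∞ Real.artanh x := by
  have h1 : 1 - x ≠ 0 := by linarith [hx.2]
  have h2 : 1 + x ≠ 0 := by linarith [hx.1]
  have h : ContDiffAt ℝ ∞ (fun x : ℝ => 1 / 2 * Real.log ((1 + x) / (1 - x))) x := by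
    refine contDiffAt_const.mul (ContDiffAt.log ?_ (div_ne_zero h2 h1))
    exact (contDiffAt_const.add contDiffAt_id).div (contDiffAt_const.sub contDiffAt_id) h1
  refine h.congr_of_eventuallyEq ?_
  filter_upwards [Ioo_mem_nhds hx.1 hx.2] with y hy
  exact Real.artanh_eq_half_log (Ioo_subset_Icc_self hy)

lemma tanh_le_tanh {x y : ℝ} (h : x ≤ y) : Real.tanh x ≤ Real.tanh y := by
  by_contra! hlt
  have := (Real.artanh_lt_artanh_iff ⟨Real.neg_one_lt_tanh y, Real.tanh_lt_one y⟩
    ⟨Real.neg_one_lt_tanh x, Real.tanh_lt_one x⟩).2 hlt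
  rw [Real.artanh_tanh, Real.artanh_tanh] at this
  linarith

/-- There is a smooth function `κ` on the line such that `κ (tanh t)` has derivative `η t * tail t`,
with a cutoff function `η` that equals `1` on `[-T, T]`. -/
lemma exists_smooth_comp_tanh {T : ℝ} (hT : 0 < T) : ∃ κ η : ℝ → ℝ,
    ContDiff ℝ ∞ κ ∧ Continuous η ∧ HasCompactSupport η ∧ (∀ t, 0 ≤ η t ∧ η t ≤ 1) ∧
    (∀ t ∈ Icc (-T) T, η t = 1) ∧
    ∀ t, HasDerivAt (fun s => κ (Real.tanh s)) (η t * tail t) t := by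
  have hT0 : 0 < Real.tanh T := by
    rw [Real.tanh_eq_sinh_div_cosh]
    exact div_pos (Real.sinh_pos_iff.2 hT) (Real.cosh_pos T)
  have hT1 := Real.tanh_lt_one T
  let f : ContDiffBump (0 : ℝ) := ⟨Real.tanh T, (1 + Real.tanh T) / 2, hT0, by linarith⟩
  have hf0 : ∀ x : ℝ, f.rOut ≤ |x| → f x = 0 := fun x hx => f.zero_of_le_dist (by simpa using hx)
  have hr : f.rOut < 1 := by change (1 + Real.tanh T) / 2 < 1; linarith
  have htanh : Continuous Real.tanh :=
    continuous_iff_continuousAt.2 fun t => (hasDerivAt_tanh t).continuousAt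
  set k : ℝ → ℝ := fun x => f x * tail (Real.artanh x) / (1 - x ^ 2) with hk
  have hkd : ContDiff ℝ ∞ k := by
    rw [contDiff_iff_contDiffAt]
    intro x
    rcases lt_or_ge |x| 1 with hx | hx
    · have hx' := abs_lt.1 hx
      have h0 : 1 - x ^ 2 ≠ 0 := by nlinarith [hx'.1, hx'.2]
      exact ((f.contDiff.contDiffAt).mul ((contDiff_tail.contDiffAt).comp x
        (contDiffAt_artanh hx'))).div (by fun_prop) h0
    · refine (contDiffAt_const (c := (0 : ℝ))).congr_of_eventuallyEq ?_
      filter_upwards [(isOpen_lt continuous_const continuous_abs).mem_nhds (hr.trans_le hx)]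
        with y hy
      simp [hk, hf0 y (le_of_lt hy)]
  have hkc : Continuous k := hkd.continuous
  have hκ : ∀ x, HasDerivAt (fun x => ∫ y in (0 : ℝ)..x, k y) (k x) x := fun x =>
    intervalIntegral.integral_hasDerivAt_right (hkc.intervalIntegrable _ _)
      (hkc.stronglyMeasurableAtFilter _ _) hkc.continuousAt
  refine ⟨fun x => ∫ y in (0 : ℝ)..x, k y, fun t => f (Real.tanh t), ?_,
    f.continuous.comp htanh, ?_, fun t => ⟨f.nonneg, f.le_one⟩, fun t ht => ?_, fun t => ?_⟩
  · rw [contDiff_infty_iff_deriv]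
    refine ⟨fun x => (hκ x).differentiableAt, ?_⟩
    rwa [show deriv _ = k from funext fun x => (hκ x).deriv]
  · refine HasCompactSupport.of_support_subset_isCompact
      (isCompact_Icc (a := Real.artanh (-f.rOut)) (b := Real.artanh f.rOut)) fun t ht => ?_
    have h1 : |Real.tanh t| < f.rOut := not_le.1 fun h => ht (hf0 _ h)
    have h2 := abs_lt.1 h1
    have h3 := Real.artanh_le_artanh (by linarith) (Real.tanh_lt_one t) h2.1.le
    have h4 := Real.artanh_le_artanh (Real.neg_one_lt_tanh t) hr h2.2.le
    rw [Real.artanh_tanh] at h3 h4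
    exact ⟨h3, h4⟩
  · refine f.one_of_mem_closedBall ?_
    rw [mem_closedBall_zero_iff, Real.norm_eq_abs, abs_le]
    change -Real.tanh T ≤ _ ∧ _ ≤ Real.tanh T
    rw [← Real.tanh_neg]
    exact ⟨tanh_le_tanh ht.1, tanh_le_tanh ht.2⟩
  · refine ((hκ (Real.tanh t)).comp t (hasDerivAt_tanh t)).congr_deriv ?_
    have h0 : 1 - Real.tanh t ^ 2 ≠ 0 := by linarith [Real.tanh_sq_lt_one t]
    simp only [hk, Real.artanh_tanh]
    exact div_mul_cancel₀ _ h0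

/-! ### The counterexample on the disc -/

lemma hasGradientAt_comp_coord_re {f : ℝ → ℝ} {f' : ℝ} {p : Plane} (hp : p ∈ disc)
    (hf : HasDerivAt f f' (coord p).re) :
    HasGradientAt (fun p => f (coord p).re) (f' • gradT p) p := by
  refine (hf.comp_hasFDerivAt p (hasGradientAt_coord_re hp).hasFDerivAt).congr_fderiv ?_
  rw [map_smul]

lemma continuousOn_comp_coord_re {f : ℝ → ℝ} (hf : Continuous f) :
    ContinuousOn (fun p => f (coord p).re) disc :=
  hf.comp_continuousOn (Complex.continuous_re.comp_continuousOn continuousOn_coord)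

/-- The function `a`. -/
noncomputable def exA (p : Plane) : ℝ := profA (coord p).re

/-- The function `b`. -/
noncomputable def exB (p : Plane) : ℝ := profB (coord p).re * (coord p).im

/-- The gradient of `a`. -/
noncomputable def gradExA (p : Plane) : Plane := profA' (coord p).re • gradT p

/-- The gradient of `b`. -/
noncomputable def gradExB (p : Plane) : Plane :=
  (profB' (coord p).re * (coord p).im) • gradT p + profB (coord p).re • gradTheta p

lemma abs_coord_im_le {p : Plane} (hp : p ∈ disc) : |(coord p).im| ≤ 2 := by
  have h := coord_mem_strip hp
  have h3 := Real.pi_lt_four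
  exact abs_le.2 ⟨by linarith [h.1], by linarith [h.2]⟩

lemma memLp_top_exA : MemLp exA ∞ discMeasure := by
  refine memLp_top_of_bound
    (aestronglyMeasurable_disc (continuousOn_comp_coord_re continuous_profA)) 1
    (Eventually.of_forall fun p => (abs_profA_le _).trans (amp_le_one _))

lemma memLp_top_exB : MemLp exB ∞ discMeasure := by
  refine memLp_top_of_bound (aestronglyMeasurable_disc
    ((continuousOn_comp_coord_re continuous_profB).mul
      (Complex.continuous_im.comp_continuousOn continuousOn_coord))) (1 * 2) ?_
  filter_upwards [ae_mem_disc] with p hp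
  rw [exB, norm_mul]
  exact mul_le_mul ((abs_profB_le _).trans (amp_le_one _)) (abs_coord_im_le hp) (norm_nonneg _)
    zero_le_one

lemma hasWeakGradient_exA : HasWeakGradient 2 exA gradExA := by
  refine .of_hasGradientAt one_le_two
    (fun p hp => hasGradientAt_comp_coord_re hp (hasDerivAt_profA _))
    (memLp_top_exA.mono_exponent le_top) ?_
  refine memLp_two_of_norm_sq_le
    ((continuousOn_comp_coord_re continuous_profA').smul continuousOn_gradT)
    (integrable_amp_sq.const_mul 4) fun p _ => ?_
  rw [gradExA, norm_smul, mul_pow]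
  refine mul_le_mul_of_nonneg_right ?_ (sq_nonneg _)
  calc ‖profA' (coord p).re‖ ^ 2 ≤ (2 * amp (coord p).re) ^ 2 :=
        pow_le_pow_left₀ (norm_nonneg _) (abs_profA'_le _) 2
    _ = _ := by ring

lemma norm_gradExB_le {p : Plane} (hp : p ∈ disc) :
    ‖gradExB p‖ ≤ 5 * amp (coord p).re * ‖gradT p‖ := by
  have h1 := abs_profB_le (coord p).re
  have h2 := abs_profB'_le (coord p).re
  have h3 := abs_coord_im_le hp
  have h0 := amp_pos (coord p).re
  refine (norm_add_le _ _).trans ?_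
  rw [norm_smul, norm_smul, norm_gradTheta, norm_mul, ← add_mul]
  refine mul_le_mul_of_nonneg_right ?_ (norm_nonneg _)
  have h4 : |profB' (coord p).re| * |(coord p).im| ≤ 2 * amp (coord p).re * 2 :=
    mul_le_mul h2 h3 (abs_nonneg _) (by positivity)
  simp only [Real.norm_eq_abs]
  linarith

lemma hasWeakGradient_exB : HasWeakGradient 2 exB gradExB := by
  have him : ContinuousOn (fun p => (coord p).im) disc :=
    Complex.continuous_im.comp_continuousOn continuousOn_coord
  refine .of_hasGradientAt one_le_two (fun p hp => ?_) (memLp_top_exB.mono_exponent le_top) ?_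
  · refine ((hasGradientAt_comp_coord_re hp (hasDerivAt_profB _)).hasFDerivAt.mul
      (hasGradientAt_coord_im hp).hasFDerivAt).congr_fderiv ?_
    simp only [gradExB, map_add, map_smul, smul_smul]
    rw [add_comm, mul_comm (coord p).im]
  · refine memLp_two_of_norm_sq_le
      ((((continuousOn_comp_coord_re continuous_profB').mul him).smul continuousOn_gradT).add
        ((continuousOn_comp_coord_re continuous_profB).smul continuousOn_gradTheta))
      (integrable_amp_sq.const_mul 25) fun p hp => ?_
    calc ‖gradExB p‖ ^ 2 ≤ (5 * amp (coord p).re * ‖gradT p‖) ^ 2 :=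
          pow_le_pow_left₀ (norm_nonneg _) (norm_gradExB_le hp) 2
      _ = _ := by ring

lemma inner_gradExA_perp_gradExB (p : Plane) :
    inner ℝ (gradExA p) (perp (gradExB p))
      = -(profA' (coord p).re * profB (coord p).re * ‖gradT p‖ ^ 2) := by
  rw [gradExA, gradExB, perp_add, perp_smul, perp_smul, perp_gradT, perp_gradTheta, inner_add_right,
    inner_smul_left, inner_smul_left, inner_smul_right, inner_smul_right, inner_neg_right,
    inner_gradT_gradTheta, real_inner_self_eq_norm_sq]
  simp
  ring

/-- The weak equation for the potential with gradient `flux(t) ∇t`. -/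
lemma integral_flux_mul {ζ : Plane → ℝ} (hζ : ContDiff ℝ ∞ ζ) :
    ∫ p, flux (coord p).re * fderiv ℝ ζ p (gradT p) ∂discMeasure
      = ∫ p, inner ℝ (gradExA p) (perp (gradExB p)) * ζ p ∂discMeasure := by
  rw [integral_mul_fderiv_gradT hasDerivAt_flux (C := 2)
    (fun t => (abs_flux_le t).trans (by linarith [tail_le_one t]))
    (tendsto_flux tendsto_abs_atBot_atTop) (tendsto_flux tendsto_abs_atTop_atTop)
    (continuous_profA'.mul continuous_profB) integrable_profA'_mul_profB hζ, ← integral_neg]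
  simp only [inner_gradExA_perp_gradExB, neg_mul]

lemma exists_zeroMeanNeumannSolution : ∃ φ : Plane → ℝ,
    IsZeroMeanNeumannSolution (fun x => inner ℝ (gradExA x) (perp (gradExB x))) φ := by
  set Φ : ℝ → ℝ := fun t => ∫ s in (0 : ℝ)..t, flux s with hΦ
  have hd : ∀ t, HasDerivAt Φ (flux t) t := fun t =>
    intervalIntegral.integral_hasDerivAt_right (continuous_flux.intervalIntegrable _ _)
      (continuous_flux.stronglyMeasurableAtFilter _ _) continuous_flux.continuousAt
  have hcΦ : Continuous Φ := continuous_iff_continuousAt.2 fun t => (hd t).continuousAt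
  have hb : ∀ t, |flux t| ≤ 2 := fun t => (abs_flux_le t).trans (by linarith [tail_le_one t])
  have hΦb : ∀ t, |Φ t| ≤ 2 * |t| := fun t => by
    have := intervalIntegral.norm_integral_le_of_norm_le_const (a := 0) (b := t) (C := 2)
      (f := flux) (fun x _ => hb x)
    simpa using this
  have hint : Integrable (fun p => Φ (coord p).re) discMeasure := by
    refine (integrable_norm_gradT.const_mul 2).mono'
      (aestronglyMeasurable_disc (continuousOn_comp_coord_re hcΦ)) ?_
    filter_upwards [ae_mem_disc] with p hp
    have h1 : |(coord p).re| ≤ Real.cosh (coord p).re := by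
      have h2 := Real.self_le_sinh_iff.2 (abs_nonneg (coord p).re)
      rw [← Real.cosh_abs]
      exact h2.trans (Real.sinh_lt_cosh _).le
    have := cosh_le_norm_gradT hp
    have := hΦb (coord p).re
    rw [Real.norm_eq_abs]
    linarith
  have hgrad : Integrable (fun p => flux (coord p).re • gradT p) discMeasure := by
    refine (integrable_norm_gradT.const_mul 2).mono' (aestronglyMeasurable_disc
      ((continuousOn_comp_coord_re continuous_flux).smul continuousOn_gradT)) ?_
    refine Eventually.of_forall fun p => ?_
    rw [norm_smul]
    exact mul_le_mul_of_nonneg_right (hb _) (norm_nonneg _)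
  set c : ℝ := ⨍ p, Φ (coord p).re ∂discMeasure with hc
  refine ⟨fun p => Φ (coord p).re - c, ?_, fun p => flux (coord p).re • gradT p, ?_, ?_⟩
  · exact integral_sub_average discMeasure _
  · refine .of_hasGradientAt le_rfl
      (fun p hp => hasGradientAt_comp_coord_re hp ((hd _).sub_const c)) ?_ ?_
    · exact memLp_one_iff_integrable.2 (hint.sub (integrable_const c))
    · exact memLp_one_iff_integrable.2 hgrad
  · intro ζ hζ
    rw [← integral_flux_mul hζ]
    simp only [sum_mul_partialDeriv, map_smul, smul_eq_mul]

/-- On the disc, `tanh t` is the restriction of a function that is smooth on the whole plane. -/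
lemma tanh_coord_re {p : Plane} (hp : p ∈ disc) :
    Real.tanh (coord p).re = 2 * p 0 / (1 + ‖p‖ ^ 2) := by
  set z := ofComplex.symm p with hz
  have hz1 : ‖z‖ < 1 := norm_ofComplex_symm_lt hp
  have h1 : 0 < ‖1 - z‖ := norm_pos_iff.2 (one_sub_ne_zero_of_norm_lt hz1)
  have h2 : 0 < ‖1 + z‖ := norm_pos_iff.2 (one_add_ne_zero_of_norm_lt hz1)
  have hn : ‖p‖ = ‖z‖ := by rw [hz, LinearIsometryEquiv.norm_map]
  have hre : p 0 = z.re := by simp [hz, ofComplex]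
  have he : Real.exp (coord p).re = ‖1 + z‖ / ‖1 - z‖ := by
    rw [coord, ← Complex.norm_exp, exp_toStrip hz1, norm_div]
  have e1 : ‖1 + z‖ ^ 2 = 1 + 2 * z.re + ‖z‖ ^ 2 := by
    simp only [Complex.sq_norm, Complex.normSq_apply, Complex.add_re, Complex.add_im,
      Complex.one_re, Complex.one_im]
    ring
  have e2 : ‖1 - z‖ ^ 2 = 1 - 2 * z.re + ‖z‖ ^ 2 := by
    simp only [Complex.sq_norm, Complex.normSq_apply, Complex.sub_re, Complex.sub_im,
      Complex.one_re, Complex.one_im]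
    ring
  have h3 : Real.tanh (coord p).re
      = (‖1 + z‖ ^ 2 - ‖1 - z‖ ^ 2) / (‖1 + z‖ ^ 2 + ‖1 - z‖ ^ 2) := by
    rw [Real.tanh_eq, Real.exp_neg, he]
    field_simp
  have h4 : 1 + ‖z‖ ^ 2 ≠ 0 := by positivity
  rw [h3, e1, e2, hn, hre]
  have h5 : 1 + 2 * z.re + ‖z‖ ^ 2 + (1 - 2 * z.re + ‖z‖ ^ 2) ≠ 0 := by
    ring_nf
    positivity
  field_simp
  ring

lemma contDiff_two_mul_div :
    ContDiff ℝ ∞ fun p : Plane => 2 * p 0 / (1 + ‖p‖ ^ 2) := by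
  have h1 : ContDiff ℝ ∞ fun p : Plane => p 0 :=
    (EuclideanSpace.proj (𝕜 := ℝ) (0 : Fin 2)).contDiff
  have h2 : ContDiff ℝ ∞ fun p : Plane => ‖p‖ ^ 2 := contDiff_norm_sq ℝ
  exact (contDiff_const.mul h1).div (contDiff_const.add h2) fun p => by positivity

lemma hasGradientAt_comp_div {κ : ℝ → ℝ} {d : ℝ} {p : Plane} (hp : p ∈ disc)
    (hκ : HasDerivAt (fun s => κ (Real.tanh s)) d (coord p).re) :
    HasGradientAt (fun p : Plane => κ (2 * p 0 / (1 + ‖p‖ ^ 2))) (d • gradT p) p := by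
  refine (hasGradientAt_comp_coord_re hp hκ).congr_of_eventuallyEq ?_
  filter_upwards [Metric.isOpen_ball.mem_nhds hp] with x hx
  rw [tanh_coord_re hx]

/-- Test functions that depend on `t` alone in the disc, with derivative `h(t)` equal to
`(1 + t²)^(-1/4)` on a given interval. -/
lemma exists_testFunction {T : ℝ} (hT : 0 < T) : ∃ (ζ : Plane → ℝ) (h : ℝ → ℝ),
    ContDiff ℝ ∞ ζ ∧ (∀ p ∈ disc, ∀ v, fderiv ℝ ζ p v = h (coord p).re * inner ℝ (gradT p) v) ∧
    Integrable (fun t => h t ^ 2) ∧ ∫ t, flux t * h t ≤ -(3 / 4) * ∫ t, h t ^ 2 ∧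
    ∀ t ∈ Icc (-T) T, h t ^ 2 = (bracket t)⁻¹ := by
  obtain ⟨κ, η, hκ, hη, hηc, hη01, hη1, hκd⟩ := exists_smooth_comp_tanh hT
  have hhc : Continuous fun t => η t * tail t := hη.mul contDiff_tail.continuous
  have hhs : HasCompactSupport fun t => η t * tail t := hηc.mul_right
  have hi2 : Integrable fun t => (η t * tail t) ^ 2 := by
    simp only [sq]
    exact (hhc.mul hhc).integrable_of_hasCompactSupport hhs.mul_right
  refine ⟨fun p => κ (2 * p 0 / (1 + ‖p‖ ^ 2)), fun t => η t * tail t, ?_, fun p hp v => ?_, hi2,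
    ?_, fun t ht => ?_⟩
  · exact hκ.comp contDiff_two_mul_div
  · rw [(hasGradientAt_comp_div hp (hκd (coord p).re)).fderiv_apply, real_inner_smul_left]
  · rw [← integral_const_mul]
    refine integral_mono ((continuous_flux.mul hhc).integrable_of_hasCompactSupport hhs.mul_left)
      (hi2.const_mul _) fun t => ?_
    have h1 := flux_le t
    have h2 := tail_pos t
    obtain ⟨h3, h4⟩ := hη01 t
    have h5 : flux t * (η t * tail t) ≤ -(3 / 4) * tail t * (η t * tail t) :=
      mul_le_mul_of_nonneg_right h1 (by positivity)
    have h6 : η t * (η t * tail t ^ 2) ≤ 1 * (η t * tail t ^ 2) :=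
      mul_le_mul_of_nonneg_right h4 (by positivity)
    change flux t * (η t * tail t) ≤ -(3 / 4) * (η t * tail t) ^ 2
    linarith
  · simp only [hη1 t ht, one_mul, tail_sq]

/-- For a test function that depends on `t` alone, the right-hand side of the equation is evaluated
by means of the explicit potential. -/
lemma integral_rhs_mul_testFunction {ζ : Plane → ℝ} {h : ℝ → ℝ} (hζ : ContDiff ℝ ∞ ζ)
    (hfd : ∀ p ∈ disc, ∀ v, fderiv ℝ ζ p v = h (coord p).re * inner ℝ (gradT p) v) :
    ∫ x, inner ℝ (gradExA x) (perp (gradExB x)) * ζ x ∂discMeasure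
      = Real.pi * ∫ t, flux t * h t := by
  rw [← integral_flux_mul hζ, ← integral_coord_mul]
  refine setIntegral_congr_fun measurableSet_disc fun p hp => ?_
  simp only [hfd p hp, real_inner_self_eq_norm_sq]
  ring

/-- The bound follows from `|u v| ≤ u² + v² / 4`; the weight `1 / 4` keeps the second term below the
factor `3 / 4` of `exists_testFunction`. -/
lemma abs_integral_fderiv_testFunction_le {ζ : Plane → ℝ} {h : ℝ → ℝ} {G : Plane → Plane}
    (hfd : ∀ p ∈ disc, ∀ v, fderiv ℝ ζ p v = h (coord p).re * inner ℝ (gradT p) v)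
    (hi2 : Integrable fun t => h t ^ 2) (hG : MemLp G 2 discMeasure) :
    |∫ x, fderiv ℝ ζ x (G x) ∂discMeasure|
      ≤ (∫ x, ‖G x‖ ^ 2 ∂discMeasure) + Real.pi * (1 / 4 * ∫ t, h t ^ 2) := by
  have hGi : Integrable (fun x => ‖G x‖ ^ 2) discMeasure :=
    (memLp_two_iff_integrable_sq_norm hG.1).1 hG
  have hi4 := integrable_coord_mul (hi2.const_mul (1 / 4))
  have hint := integral_coord_mul fun t => 1 / 4 * h t ^ 2
  rw [integral_const_mul] at hint
  rw [← hint, ← integral_add hGi hi4]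
  rw [← Real.norm_eq_abs]
  refine norm_integral_le_of_norm_le (hGi.add hi4) ?_
  filter_upwards [ae_mem_disc] with x hx
  rw [hfd x hx, norm_mul]
  have h1 : ‖(inner ℝ (gradT x) (G x) : ℝ)‖ ≤ ‖gradT x‖ * ‖G x‖ := norm_inner_le_norm _ _
  have h2 : ‖h (coord x).re‖ ^ 2 = h (coord x).re ^ 2 := by
    rw [Real.norm_eq_abs, sq_abs]
  have h3 := mul_le_mul_of_nonneg_left h1 (norm_nonneg (h (coord x).re))
  have h4 := sq_nonneg (‖G x‖ - 1 / 2 * (‖h (coord x).re‖ * ‖gradT x‖))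
  rw [← h2]
  linarith

/-- A solution with square integrable gradient `G` bounds `∫ (1 + t²)^(-1/2)` over every interval.
For a test function with derivative `h`, the right-hand side is at most `-(3/4) π ∫ h²`, while the
left-hand side is at least `-∫ |G|² - (1/4) π ∫ h²`. -/
lemma integral_inv_bracket_le {ψ : Plane → ℝ} {Ψ G : Plane → Plane}
    (hΨ : HasWeakGradient 1 ψ Ψ)
    (heq : ∀ ζ : Plane → ℝ, ContDiff ℝ ∞ ζ →
      ∫ x, ∑ i : Fin 2, Ψ x i * partialDeriv i ζ x ∂discMeasure
        = ∫ x, inner ℝ (gradExA x) (perp (gradExB x)) * ζ x ∂discMeasure)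
    (hG : HasWeakGradient 2 ψ G) {T : ℝ} (hT : 0 < T) :
    ∫ t in (-T)..T, ‖(bracket t)⁻¹‖ ≤ 2 / Real.pi * ∫ x, ‖G x‖ ^ 2 ∂discMeasure := by
  obtain ⟨ζ, h, hζ, hfd, hi2, hflux, hhT⟩ := exists_testFunction hT
  have hL : ∫ x, fderiv ℝ ζ x (G x) ∂discMeasure = Real.pi * ∫ t, flux t * h t := by
    rw [← integral_rhs_mul_testFunction hζ hfd, ← heq ζ hζ]
    refine integral_congr_ae ?_
    filter_upwards [hΨ.ae_eq le_rfl one_le_two hG] with x hx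
    rw [sum_mul_partialDeriv, hx]
  have hbound := (abs_le.1 (abs_integral_fderiv_testFunction_le hfd hi2 hG.memLp_grad)).1
  rw [hL] at hbound
  have hpi := Real.pi_pos
  have hX : ∫ t, h t ^ 2 ≤ 2 / Real.pi * ∫ x, ‖G x‖ ^ 2 ∂discMeasure := by
    have h1 := mul_le_mul_of_nonneg_left hflux hpi.le
    rw [div_mul_eq_mul_div, le_div_iff₀ hpi]
    linarith
  refine le_trans ?_ hX
  rw [intervalIntegral.integral_of_le (by linarith)]
  calc ∫ t in Ioc (-T) T, ‖(bracket t)⁻¹‖ = ∫ t in Ioc (-T) T, h t ^ 2 := by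
        refine setIntegral_congr_fun measurableSet_Ioc fun t ht => ?_
        simp only [hhT t (Ioc_subset_Icc_self ht)]
        exact Real.norm_of_nonneg (inv_nonneg.2 (bracket_pos t).le)
    _ ≤ ∫ t, h t ^ 2 := setIntegral_le_integral hi2 (Eventually.of_forall fun t => sq_nonneg _)

lemma not_memH1_of_isZeroMeanNeumannSolution {ψ : Plane → ℝ}
    (hψ : IsZeroMeanNeumannSolution (fun x => inner ℝ (gradExA x) (perp (gradExB x))) ψ) :
    ¬ MemH1 ψ := by
  rintro ⟨G, hG⟩
  obtain ⟨-, Ψ, hΨ, heq⟩ := hψ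
  have hc : Continuous fun t => (bracket t)⁻¹ :=
    continuous_bracket.inv₀ fun t => (bracket_pos t).ne'
  refine not_integrable_inv_bracket (integrable_of_intervalIntegral_norm_bounded
    (l := atTop) (a := fun T : ℝ => -T) (b := fun T : ℝ => T)
    (2 / Real.pi * ∫ x, ‖G x‖ ^ 2 ∂discMeasure)
    (fun T => hc.integrableOn_Ioc) tendsto_neg_atTop_atBot tendsto_id ?_)
  filter_upwards [eventually_gt_atTop 0] with T hT
  exact integral_inv_bracket_le hΨ heq hG hT

end NeumannJacobian

/-- There are `a, b ∈ (L^∞ ∩ H¹)(D²)`, with weak gradients `A = ∇a` and `B = ∇b`, such that the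
Neumann problem `-Δφ = ∇a · ∇^⊥ b`, `∂_ν φ = 0` has a zero-mean solution, and no zero-mean solution
lies in `H¹(D²)`. -/
theorem mainTheorem3 :
    ∃ (a b : NeumannJacobian.Plane → ℝ)
      (A B : NeumannJacobian.Plane → NeumannJacobian.Plane),
      MemLp a ∞ NeumannJacobian.discMeasure ∧
      MemLp b ∞ NeumannJacobian.discMeasure ∧
      NeumannJacobian.HasWeakGradient 2 a A ∧
      NeumannJacobian.HasWeakGradient 2 b B ∧
      (∃ φ : NeumannJacobian.Plane → ℝ,
        NeumannJacobian.IsZeroMeanNeumannSolution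
          (fun x => inner ℝ (A x) (NeumannJacobian.perp (B x))) φ) ∧
      ∀ φ : NeumannJacobian.Plane → ℝ,
        NeumannJacobian.IsZeroMeanNeumannSolution
          (fun x => inner ℝ (A x) (NeumannJacobian.perp (B x))) φ →
        ¬ NeumannJacobian.MemH1 φ :=
  ⟨NeumannJacobian.exA, NeumannJacobian.exB, NeumannJacobian.gradExA, NeumannJacobian.gradExB,
    NeumannJacobian.memLp_top_exA, NeumannJacobian.memLp_top_exB,
    NeumannJacobian.hasWeakGradient_exA, NeumannJacobian.hasWeakGradient_exB,
    NeumannJacobian.exists_zeroMeanNeumannSolution,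
    fun _ hφ => NeumannJacobian.not_memH1_of_isZeroMeanNeumannSolution hφ⟩
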